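/- **Conventions.** Vertices are elements of a fixed linearly ordered set, $\mathbb N=\{1,2,\dots\}$. A *route* of length $N$ through a finite vertex set $V$ is a sequence $\boldsymbol i=(i_1,\dots,i_N)$ in which exactly the elements of $V$ occur. Its *circuit multigraph* $G_{\boldsymbol i}$ has vertex set $V$ and the numbered directed edges $1,\dots,N$, where edge $k$ goes from its tail $i_k$ to its head $i_{k+1}$ (with $i_{N+1}:=i_1$). Let $\mathcal C_{V,N}$ be the set of all circuit multigraphs on $V$ of length $N$. A vertex $v$ of $G\in\mathcal C_{V,N}$, $N>2$, is a *balanced leaf* if exactly one edge has head $v$, exactly one edge has tail $v$, and both edges are between $v$ and one other vertex $w\neq v$; for $N\le 2$ there are no balanced leaves. *Removing* a balanced leaf $v$ from $G_{\boldsymbol i}$ gives the circuit multigraph of the route obtained from $\boldsymbol i$ by deleting the single occurrence of $v$ together with the next entry or, if $v$ is the last entry, together with the previous entry. The *seed graph* $\operatorname S(G)$ is obtained from $G$ by removing the smallest balanced leaf repeatedly until there are no balanced leaves. A vertex of $G$ is *white* if it is the tail of even-numbered edges only, and *black* otherwise; $B(G)$ is the set of black vertices. **Proposition (Counting sprouting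 graphs).** Let $l_0\in\mathbb N$ and let $B',W'$ be disjoint finite sets of vertices (possibly empty), $b'=\#B'$, $w'=\#W'$. 1. Let $v_1\ne v_2$ be two vertices, both larger than every element of $B'\sqcup W'$, and let $G_0\in\mathcal C_{\{v_1,v_2\},2l_0}$ be the circuit multigraph with route $(v_1,v_2,v_1,v_2,\dots,v_1,v_2)$ of length $2l_0$. Then $$\#\{G\in\mathcal C_{\{v_1,v_2\}\sqcup B'\sqcup W',\,2l_0+2b'+2w'}\mid \operatorname S(G)=G_0,\ B(G)\cap(B'\sqcup W')=B'\}=\frac{(l_0+b'+w')!^2}{(l_0+b')!\,(l_0+w')!}.$$ 2. Let $V_0$ be any finite set of vertices disjoint from $B'\sqcup W'$ and let $G_0\in\mathcal C_{V_0,2l_0}$ have no balanced leaves. If $l_0=1$ and $\#V_0=2$, assume that both elements of $V_0$ are larger than every element of $B'\sqcup W'$; otherwise nothing is assumed about the order of the vertices. Then likewise $$\#\{G\in\mathcal C_{V_0\sqcup B'\sqcup W',\,2l_0+2b'+2w'}\mid \operatorname S(G)=G_0,\ B(G)\cap(B'\sqcup W')=B'\}=\frac{(l_0+b'+w')!^2}{(l_0+b')!\,(l_0+w')!}.$$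 -/

import Mathlib

/-- A linearly ordered directed multigraph: a finite vertex set `verts` contained in a linearly
ordered type, edges `0, ..., numEdges - 1` (the `k`-th edge of the usual one-based numbering is the
edge `k - 1` here), and for every edge `e` the pair `f e = (tail of e, head of e)`. -/
@[ext]
structure LinMultigraph (α : Type*) where
  verts : Finset α
  numEdges : ℕ
  f : Fin numEdges → α × α
  tail_mem : ∀ e, (f e).1 ∈ verts
  head_mem : ∀ e, (f e).2 ∈ verts

namespace LinMultigraph

variable {α : Type*} [LinearOrder α]

/-- The circuit multigraph of a route `i = (i_1, ..., i_N)`: its vertices are the entries of `i`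
and its edges are `(i_1, i_2), (i_2, i_3), ..., (i_N, i_1)`, in this order. -/
def ofRoute (i : List α) : LinMultigraph α where
  verts := i.toFinset
  numEdges := i.length
  f k := (i[k.val], i[(k.val + 1) % i.length]'(Nat.mod_lt _ (Nat.zero_lt_of_lt k.isLt)))
  tail_mem e := by simp
  head_mem e := by simp

/-- The set of circuit multigraphs on `V` of length `N`: the graphs of the routes of length `N`
in which exactly the elements of `V` occur. -/
def circuitMultigraphs (V : Finset α) (N : ℕ) : Set (LinMultigraph α) :=
  {G | ∃ i : List α, i.length = N ∧ i.toFinset = V ∧ G = ofRoute i}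

/-- The sequence of the tails of the edges; for a circuit multigraph this is its route. -/
def route (G : LinMultigraph α) : List α := List.ofFn fun e => (G.f e).1

/-- `v` is a balanced leaf: there is exactly one edge `e` with head `v`, exactly one edge `e'` with
tail `v`, and both are between `v` and one other vertex `w`. By convention a graph with at most two
edges has no balanced leaves. -/
def IsBalancedLeaf (G : LinMultigraph α) (v : α) : Prop :=
  2 < G.numEdges ∧ ∃ w, w ≠ v ∧ ∃ e e' : Fin G.numEdges,
    (∀ d, (G.f d).2 = v ↔ d = e) ∧ (∀ d, (G.f d).1 = v ↔ d = e') ∧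
    G.f e = (w, v) ∧ G.f e' = (v, w)

open Classical in
/-- The finite set of balanced leaves of `G`. -/
noncomputable def balancedLeaves (G : LinMultigraph α) : Finset α :=
  G.verts.filter fun v => G.IsBalancedLeaf v

/-- Delete from a route the (first) occurrence of `v` together with the next entry or, if `v` is the
last entry of the route, together with the previous entry. -/
def removeFromRoute (i : List α) (v : α) : List α :=
  if i.idxOf v + 1 = i.length then i.take (i.idxOf v - 1)
  else i.take (i.idxOf v) ++ i.drop (i.idxOf v + 2)

/-- The version of the circuit multigraph `G` with its balanced leaf `v` removed. -/
def removeLeaf (G : LinMultigraph α) (v : α) : LinMultigraph α :=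
  ofRoute (removeFromRoute G.route v)

open Classical in
theorem removeLeaf_numEdges_lt {G : LinMultigraph α} {v : α} (h : v ∈ G.balancedLeaves) :
    (G.removeLeaf v).numEdges < G.numEdges := by
  rw [balancedLeaves, Finset.mem_filter] at h
  obtain ⟨-, h2, w, -, e, e', -, -, -, he'⟩ := h
  have hv : v ∈ G.route := List.mem_ofFn.mpr ⟨e', by rw [he']⟩
  have hlen : G.route.length = G.numEdges := by simp [route]
  have hidx : G.route.idxOf v < G.route.length := List.idxOf_lt_length_iff.mpr hv
  simp only [removeLeaf, ofRoute, removeFromRoute]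
  split <;> simp only [List.length_take, List.length_append, List.length_drop] <;> omega

/-- The seed graph of a circuit multigraph: as long as there are balanced leaves, remove the
smallest one. -/
noncomputable def seed (G : LinMultigraph α) : LinMultigraph α :=
  if h : G.balancedLeaves.Nonempty then seed (G.removeLeaf (G.balancedLeaves.min' h)) else G
termination_by G.numEdges
decreasing_by exact removeLeaf_numEdges_lt (Finset.min'_mem _ h)

open Classical in
/-- The black vertices. A vertex is white if it is only tail of even numbered edges, so it is black
if it is tail of some odd numbered edge (in the one-based numbering of the edges). -/
noncomputable def black (G : LinMultigraph α) : Finset α :=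
  G.verts.filter fun v => ∃ e : Fin G.numEdges, Odd (e.val + 1) ∧ (G.f e).1 = v

/-- The circuit multigraphs `G` on the vertices of `G₀` together with the sprouting vertices
`B' ∪ W'`, with two more edges than `G₀` for every sprouting vertex, whose seed graph is `G₀`
and whose black sprouting vertices are exactly those in `B'`. -/
def sproutingGraphs (G₀ : LinMultigraph α) (B' W' : Finset α) : Set (LinMultigraph α) :=
  {G | G ∈ circuitMultigraphs (G₀.verts ∪ (B' ∪ W')) (G₀.numEdges + 2 * (B'.card + W'.card)) ∧
    G.seed = G₀ ∧ G.black ∩ (B' ∪ W') = B'}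

/-- The circuit multigraph with route `(v₁, v₂, v₁, v₂, ..., v₁, v₂)` of length `2 * l₀`. -/
def alternating (l₀ : ℕ) (v₁ v₂ : α) : LinMultigraph α :=
  ofRoute (List.replicate l₀ [v₁, v₂]).flatten

end LinMultigraph

/-!
The right-hand side is `L.descFactorial b' * L.descFactorial w'` with `L = l₀ + b' + w'`, that is, the
number of ways to mark positions of a cyclic word of length `2 * L` with the sprouting vertices, each
used once, such that black vertices are at positions of one parity and white ones at positions of the
other (`ncard_markings`). The idea is that a sprouting graph is the seed circuit with trees attached,
and that it corresponds to the marking of the positions at which the sprouting vertices are left for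
the last time. Read as parentheses, a mark closes the subtree that was entered at the unmarked
position with which it is matched.

The correspondence is not constructed directly. Instead, both sides are generated in the same way by
inserting leaves. A leaf of a route is an entry that occurs once and has equal cyclic neighbours; a
leaf of a marking is a mark that is preceded by an unmarked position. A leaf `a` can be inserted at
any position `k` of the parity belonging to its colour, and for routes as well as for markings the set
of pairs (position, label) of leaves after the insertion is the same function `insertLeafData` of
`k`, `a` and the set of leaves before (`routeLeaves_insertLeaf`, `markings_leafSystem`): the leaf to
which `a` is attached is lost, the others are shifted. An object with at least one sprouting vertex
arises exactly once by inserting its least leaf, where for routes this is the definition of the seed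
graph. Hence the objects with prescribed leaves satisfy the same recursion on both sides
(`LeafSystem.nonempty_equiv_sigma`), and the two families are equinumerous (`LeafSystem.ncard_eq`).

For routes it has to be excluded that a vertex of the seed graph becomes the least leaf. Such a vertex
would already be a leaf of the seed route (`eq_one_and_card_eq_two_of_leaf`), which is impossible
unless the seed route is of the form `v₁, v₂`; in this case the vertices of the seed graph are larger
than all the others. The alternating graph of the first part is a special case of the second part.

Positions are counted from `0`, so that black vertices have even positions.
-/

namespace SproutingCount

/-! ### Positions on a cycle -/

/-- The cyclic predecessor of the position `k` among the positions `0, ..., N - 1`. -/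
def cpred (N k : ℕ) : ℕ := if k = 0 then N - 1 else k - 1

/-- The cyclic successor of the position `k` among the positions `0, ..., N - 1`. -/
def csucc (N k : ℕ) : ℕ := if k + 1 = N then 0 else k + 1

/-- When a leaf is inserted so as to occupy position `k` of a route of length `N`, this is the
position, in the old route of length `N - 2`, of the entry at which the leaf is attached. -/
def anchor (N k : ℕ) : ℕ := if k = 0 then N - 3 else if k + 1 = N then 0 else k - 1

/-- The position of the second copy of the entry at which a leaf at position `k` is attached. It
follows the leaf, except when the leaf is the last entry. -/
def dup (N k : ℕ) : ℕ := if k + 1 = N then k - 1 else k + 1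

/-- The new position of the old entry `j` when a leaf is inserted at position `k`. -/
def shift (k j : ℕ) : ℕ := if j < k then j else j + 2

/-- The position in the old route of the entry that is at position `j ≠ k` after a leaf has been
inserted at position `k`, making the length `N`. -/
def source (N k j : ℕ) : ℕ := if j = dup N k then anchor N k else if j < k then j else j - 2

/-- The new position of an old mark `j` when a new mark is inserted at position `k` of a cyclic word
of length `N`, with an unmarked position just before it. For `k = 0` the old word is rotated so that
the parities of the positions do not change: the last position becomes position `1`. -/
def markShift (N k j : ℕ) : ℕ :=
  if k = 0 then if j + 3 = N then 1 else j + 2 else if j + 1 < k then j else j + 2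

/-- The effect on the set of leaves, given as pairs (position, label), of inserting the leaf `a` at
position `k`, so that the new length is `N`: the leaf to which `a` is attached, if any, is lost. -/
def insertLeafData {α : Type*} (N k : ℕ) (a : α) (Λ : Set (ℕ × α)) : Set (ℕ × α) :=
  {p | p = (k, a) ∨ ∃ j, (j, p.2) ∈ Λ ∧ j ≠ anchor N k ∧ p.1 = shift k j}

theorem mem_insertLeafData_self {α : Type*} (N k : ℕ) (a : α) (Λ : Set (ℕ × α)) :
    (k, a) ∈ insertLeafData N k a Λ := Or.inl rfl

/-! ### Systems generated by inserting leaves -/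

/-- A family `X U` of sets of objects with labels in `U`, each having a set `leaves U x` of labelled
leaves, in which every object with `U ≠ ∅` arises in exactly one way by inserting its leaf with the
least label into a smaller object. The insertion position `k` has to be even precisely if `c a`
holds for the inserted label `a`. -/
structure LeafSystem {α σ : Type*} [LinearOrder α] (l₀ : ℕ) (c : α → Prop) (U₀ : Finset α)
    (X : Finset α → Set σ) (leaves : Finset α → σ → Set (ℕ × α))
    (ins : Finset α → ℕ → α → σ → σ) : Prop where
  exists_base : ∃ x, X ∅ = {x} ∧ leaves ∅ x = ∅
  exists_ins : ∀ U ⊆ U₀, U.Nonempty → ∀ x ∈ X U, ∃ k a x', a ∈ U ∧ k < 2 * (l₀ + U.card) ∧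
    (Even k ↔ c a) ∧ x' ∈ X (U.erase a) ∧ ins U k a x' = x ∧ ∀ p ∈ leaves U x, a ≤ p.2
  leaves_ins : ∀ U ⊆ U₀, ∀ a ∈ U, ∀ k < 2 * (l₀ + U.card), (Even k ↔ c a) →
    ∀ x ∈ X (U.erase a), leaves U (ins U k a x) =
      insertLeafData (2 * (l₀ + U.card)) k a (leaves (U.erase a) x)
  ins_mem : ∀ U ⊆ U₀, ∀ a ∈ U, ∀ k < 2 * (l₀ + U.card), (Even k ↔ c a) →
    ∀ x ∈ X (U.erase a),
      (∀ p ∈ insertLeafData (2 * (l₀ + U.card)) k a (leaves (U.erase a) x), a ≤ p.2) →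
      ins U k a x ∈ X U
  ins_inj : ∀ U ⊆ U₀, ∀ a ∈ U, ∀ k < 2 * (l₀ + U.card), (Even k ↔ c a) →
    ∀ x ∈ X (U.erase a), ∀ y ∈ X (U.erase a), ins U k a x = ins U k a y → x = y
  leaves_unique : ∀ U ⊆ U₀, ∀ x ∈ X U, ∀ k k' a,
    (k, a) ∈ leaves U x → (k', a) ∈ leaves U x → k = k'

namespace LeafSystem

variable {α σ τ : Type*} [LinearOrder α] {l₀ : ℕ} {c : α → Prop} {U₀ : Finset α}
  {X : Finset α → Set σ} {leaves : Finset α → σ → Set (ℕ × α)}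
  {ins : Finset α → ℕ → α → σ → σ}
  {Y : Finset α → Set τ} {leaves' : Finset α → τ → Set (ℕ × α)}
  {ins' : Finset α → ℕ → α → τ → τ}

/-- Removing the least leaf: the recursion for the number of objects with a prescribed property of
the set of leaves. The right-hand side involves the smaller objects only through their leaves. -/
theorem nonempty_equiv_sigma (h : LeafSystem l₀ c U₀ X leaves ins) {U : Finset α} (hU : U ⊆ U₀)
    (hne : U.Nonempty) (P : Set (ℕ × α) → Prop) :
    Nonempty ((Σ q : {q : ℕ × α // q.2 ∈ U ∧ q.1 < 2 * (l₀ + U.card) ∧ (Even q.1 ↔ c q.2)},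
      {x // x ∈ X (U.erase q.1.2) ∧
        (∀ p ∈ insertLeafData (2 * (l₀ + U.card)) q.1.1 q.1.2 (leaves (U.erase q.1.2) x),
          q.1.2 ≤ p.2) ∧
        P (insertLeafData (2 * (l₀ + U.card)) q.1.1 q.1.2 (leaves (U.erase q.1.2) x))}) ≃
      {x // x ∈ X U ∧ P (leaves U x)}) := by
  refine ⟨Equiv.ofBijective (fun s => ⟨ins U s.1.1.1 s.1.1.2 s.2.1, ?_, ?_⟩) ⟨?_, ?_⟩⟩
  · obtain ⟨⟨⟨k, a⟩, ha, hk, hc⟩, x, hx, hl, hP⟩ := s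
    exact h.ins_mem U hU a ha k hk hc x hx hl
  · obtain ⟨⟨⟨k, a⟩, ha, hk, hc⟩, x, hx, hl, hP⟩ := s
    dsimp only
    rw [h.leaves_ins U hU a ha k hk hc x hx]
    exact hP
  · rintro ⟨⟨⟨k, a⟩, ha, hk, hc⟩, x, hx, hl, hP⟩ ⟨⟨⟨k', a'⟩, ha', hk', hc'⟩, x', hx', hl', hP'⟩ heq
    simp only [Subtype.mk.injEq] at heq
    dsimp only at *
    have e := h.leaves_ins U hU a ha k hk hc x hx
    have e' := h.leaves_ins U hU a' ha' k' hk' hc' x' hx'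
    have hm := mem_insertLeafData_self (2 * (l₀ + U.card)) k a (leaves (U.erase a) x)
    have hm' := mem_insertLeafData_self (2 * (l₀ + U.card)) k' a' (leaves (U.erase a') x')
    obtain rfl : a = a' := by
      apply le_antisymm
      · exact hl (k', a') (by rw [← e, heq, e']; exact hm')
      · exact hl' (k, a) (by rw [← e', ← heq, e]; exact hm)
    obtain rfl : k = k' := by
      refine h.leaves_unique U hU _ (h.ins_mem U hU a ha k hk hc x hx hl) k k' a ?_ ?_
      · rw [e]; exact hm
      · rw [heq, e']; exact hm'
    obtain rfl := h.ins_inj U hU a ha k hk hc x hx x' hx' heq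
    rfl
  · rintro ⟨x, hx, hP⟩
    obtain ⟨k, a, x', ha, hk, hc, hx', rfl, hl⟩ := h.exists_ins U hU hne x hx
    rw [h.leaves_ins U hU a ha k hk hc x' hx'] at hl hP
    exact ⟨⟨⟨⟨k, a⟩, ha, hk, hc⟩, x', hx', hl, hP⟩, rfl⟩

/-- Two leaf systems with the same colours are equinumerous. For the induction the equivalence has
to respect the sets of leaves. -/
theorem nonempty_equiv_of_leaves (h : LeafSystem l₀ c U₀ X leaves ins)
    (h' : LeafSystem l₀ c U₀ Y leaves' ins') (U : Finset α) (hU : U ⊆ U₀)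
    (P : Set (ℕ × α) → Prop) :
    Nonempty ({x // x ∈ X U ∧ P (leaves U x)} ≃ {y // y ∈ Y U ∧ P (leaves' U y)}) := by
  induction hn : U.card using Nat.strong_induction_on generalizing U P with
  | _ n ih =>
    rcases U.eq_empty_or_nonempty with rfl | hne
    · obtain ⟨x, hx, hl⟩ := h.exists_base
      obtain ⟨y, hy, hl'⟩ := h'.exists_base
      refine ⟨⟨fun s => ⟨y, ?_, ?_⟩, fun s => ⟨x, ?_, ?_⟩, fun s => ?_, fun s => ?_⟩⟩
      · rw [hy]; rfl
      · obtain ⟨z, hz, hP⟩ := s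
        rw [hx] at hz; obtain rfl := hz
        rwa [hl', ← hl]
      · rw [hx]; rfl
      · obtain ⟨z, hz, hP⟩ := s
        rw [hy] at hz; obtain rfl := hz
        rwa [hl, ← hl']
      · obtain ⟨z, hz, hP⟩ := s
        rw [hx] at hz; obtain rfl := hz
        rfl
      · obtain ⟨z, hz, hP⟩ := s
        rw [hy] at hz; obtain rfl := hz
        rfl
    · obtain ⟨e⟩ := h.nonempty_equiv_sigma hU hne P
      obtain ⟨e'⟩ := h'.nonempty_equiv_sigma hU hne P
      refine ⟨e.symm.trans ((Equiv.sigmaCongrRight fun q => ?_).trans e')⟩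
      exact (ih (U.erase q.1.2).card (hn ▸ Finset.card_erase_lt_of_mem q.2.1) (U.erase q.1.2)
        ((Finset.erase_subset _ _).trans hU)
        (fun Λ => (∀ p ∈ insertLeafData (2 * (l₀ + U.card)) q.1.1 q.1.2 Λ, q.1.2 ≤ p.2) ∧
          P (insertLeafData (2 * (l₀ + U.card)) q.1.1 q.1.2 Λ)) rfl).some

theorem ncard_eq (h : LeafSystem l₀ c U₀ X leaves ins) (h' : LeafSystem l₀ c U₀ Y leaves' ins')
    {U : Finset α} (hU : U ⊆ U₀) : (X U).ncard = (Y U).ncard := by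
  obtain ⟨e⟩ := h.nonempty_equiv_of_leaves h' U hU fun _ => True
  simpa only [and_true] using! Nat.card_congr e

end LeafSystem

/-! ### Markings -/

section Marking

variable {α : Type*} [LinearOrder α]

/-- The markings of the positions `0, ..., 2 * L - 1` by the labels in `U`, each used once, where
the position of `u` is even precisely if `c u` holds. A marking is given by the function that maps
labels to positions, with value `0` outside `U`. -/
def markings (c : α → Prop) (L : ℕ) (U : Finset α) : Set (α → ℕ) :=
  {m | (∀ u ∈ U, m u < 2 * L ∧ (Even (m u) ↔ c u)) ∧ Set.InjOn m U ∧ ∀ u ∉ U, m u = 0}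

/-- The leaves of a marking of `N` positions are the marks that follow an unmarked position. -/
def markingLeaves (N : ℕ) (U : Finset α) (m : α → ℕ) : Set (ℕ × α) :=
  {p | p.2 ∈ U ∧ m p.2 = p.1 ∧ ∀ v ∈ U, m v ≠ cpred N p.1}

/-- Insertion of a new mark `a` at position `k`, and of an unmarked position just before it. -/
def insertMark (N : ℕ) (U : Finset α) (k : ℕ) (a : α) (m : α → ℕ) : α → ℕ := fun u =>
  if u = a then k else if u ∈ U then markShift N k (m u) else 0

/-- Otherwise the set of marked positions would be closed under taking cyclic predecessors, so that
all `N` positions would be marked. -/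
theorem exists_mem_markingLeaves {α : Type*} {N : ℕ} {U : Finset α} (hne : U.Nonempty)
    (hU : U.card < N) (m : α → ℕ) : ∃ p, p ∈ markingLeaves N U m := by
  by_contra! hno
  have key : ∀ u ∈ U, ∃ v ∈ U, m v = cpred N (m u) := by
    intro u hu
    by_contra! h
    exact hno (m u, u) ⟨hu, rfl, h⟩
  have down : ∀ d, ∀ j, (∃ u ∈ U, m u = j + d) → ∃ u ∈ U, m u = j := by
    intro d
    induction d with
    | zero => intro j h; exact h
    | succ d ih =>
      rintro j ⟨u, hu, h⟩
      obtain ⟨v, hv, h'⟩ := key u hu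
      refine ih j ⟨v, hv, ?_⟩
      rw [h', h, cpred]
      simp [← add_assoc]
  obtain ⟨u, hu⟩ := hne
  obtain ⟨v, hv, h0⟩ := down (m u) 0 ⟨u, hu, by simp⟩
  obtain ⟨w, hw, hlast⟩ := key v hv
  have hall : Finset.range N ⊆ U.image m := by
    intro j hj
    rw [Finset.mem_range] at hj
    obtain ⟨x, hx, hx'⟩ := down (N - 1 - j) j ⟨w, hw, by
      rw [hlast, h0, cpred]; simp; omega⟩
    exact Finset.mem_image.mpr ⟨x, hx, hx'⟩
  have h1 := Finset.card_le_card hall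
  have h2 := Finset.card_image_le (s := U) (f := m)
  rw [Finset.card_range] at h1
  omega

theorem markShift_lt {N k j : ℕ} (hj : j + 2 < N) : markShift N k j < N := by
  grind [markShift]

theorem even_markShift {L k j : ℕ} :
    Even (markShift (2 * L) k j) ↔ Even j := by
  simp only [Nat.even_iff]; grind [markShift]

theorem markShift_inj {N k j j' : ℕ} (hj : j + 2 < N)
    (h : markShift N k j = markShift N k j') : j = j' := by
  grind [markShift]

theorem markShift_ne {N k j : ℕ} (hk : k < N) (hj : j + 2 < N) :
    markShift N k j ≠ k ∧ markShift N k j ≠ cpred N k := by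
  grind [markShift, cpred]

theorem exists_markShift {N k j : ℕ} (hN : 4 ≤ N) (hk : k < N) (hj : j < N) (h : j ≠ k)
    (h' : j ≠ cpred N k) : ∃ j', j' + 2 < N ∧ markShift N k j' = j := by
  rcases Nat.eq_zero_or_pos k with rfl | hk0
  · by_cases h1 : j = 1
    · exact ⟨N - 3, by omega, by grind [markShift]⟩
    · exact ⟨j - 2, by grind [cpred], by grind [markShift, cpred]⟩
  · by_cases h1 : j < k
    · exact ⟨j, by grind [cpred], by grind [markShift, cpred]⟩
    · exact ⟨j - 2, by grind [cpred], by grind [markShift, cpred]⟩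

theorem cpred_markShift_anchor {N k : ℕ} (hN : 4 ≤ N) :
    cpred N (markShift N k (anchor N k)) = k := by
  grind [markShift, cpred, anchor]

theorem markShift_eq_shift {N k j : ℕ} (hj : j + 2 < N) (h : j ≠ anchor N k) :
    markShift N k j = shift k j := by
  grind [markShift, anchor, shift]

theorem cpred_shift_ne {N k j : ℕ} (hN : 4 ≤ N) (hk : k < N) (hj : j + 2 < N)
    (h : j ≠ anchor N k) : cpred N (shift k j) ≠ k := by
  grind [cpred, anchor, shift]

theorem markShift_eq_cpred_shift_iff {N k j j' : ℕ} (hN : 4 ≤ N) (hk : k < N) (hj : j + 2 < N)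
    (hj' : j' + 2 < N) (h : j ≠ anchor N k) :
    markShift N k j' = cpred N (shift k j) ↔ j' = cpred (N - 2) j := by
  grind [cpred, anchor, shift, markShift]

/-- A marking with its least leaf `a` at position `k` arises by inserting `a`, and an unmarked
position before it, into a marking of two positions fewer. The sets of leaves change in the same way
as for routes. -/
theorem markings_leafSystem (l₀ : ℕ) (hl₀ : 1 ≤ l₀) (c : α → Prop) (U₀ : Finset α) :
    LeafSystem l₀ c U₀ (fun U => markings c (l₀ + U.card) U)
      (fun U => markingLeaves (2 * (l₀ + U.card)) U)
      (fun U => insertMark (2 * (l₀ + U.card)) U) := by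
  have size : ∀ {U : Finset α} {a}, a ∈ U →
      ∃ N, 4 ≤ N ∧ 2 * (l₀ + U.card) = N ∧ 2 * (l₀ + (U.erase a).card) = N - 2 := by
    intro U a ha
    refine ⟨_, ?_, rfl, ?_⟩ <;> have := Finset.card_pos.mpr ⟨a, ha⟩
    · omega
    · rw [Finset.card_erase_of_mem ha]; omega
  constructor
  · refine ⟨fun _ => 0, ?_, ?_⟩
    · ext m
      simp [markings, funext_iff]
    · ext p
      simp [markingLeaves]
  · intro U _ hne m hm
    obtain ⟨p, hp⟩ := exists_mem_markingLeaves (N := 2 * (l₀ + U.card)) hne (by omega) m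
    classical
    -- the least leaf, among the labels whose mark follows an unmarked position
    let S := U.filter fun u => (m u, u) ∈ markingLeaves (2 * (l₀ + U.card)) U m
    have hS : S.Nonempty := ⟨p.2, by
      have h1 : (m p.2, p.2) = p := by rw [hp.2.1]
      simp only [S, Finset.mem_filter, h1]; exact ⟨hp.1, hp⟩⟩
    have hSm := S.min'_mem hS
    set a := S.min' hS with ha
    obtain ⟨haU, -, -, hfree⟩ := Finset.mem_filter.mp hSm
    obtain ⟨N, hN, hNU, hNe⟩ := size haU
    obtain ⟨hm1, hm2, hm3⟩ := hm
    dsimp only at hfree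
    have hex : ∀ u ∈ U.erase a, ∃ j', j' + 2 < N ∧ markShift N (m a) j' = m u := by
      intro u hu
      obtain ⟨hua, hu⟩ := Finset.mem_erase.mp hu
      refine exists_markShift hN (hNU ▸ (hm1 a haU).1) (hNU ▸ (hm1 u hu).1) ?_ ?_
      · exact fun h => hua (hm2 hu haU h)
      · rw [← hNU]; exact hfree u hu
    choose! g hg hg' using hex
    refine ⟨m a, a, fun u => if u ∈ U.erase a then g u else 0, haU, (hm1 a haU).1, (hm1 a haU).2,
      ⟨?_, ?_, ?_⟩, ?_, ?_⟩
    · intro u hu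
      simp only [hu, if_true, hNe]
      refine ⟨by have := hg u hu; omega, ?_⟩
      rw [← (hm1 u (Finset.mem_of_mem_erase hu)).2, ← hg' u hu, ← hNU, even_markShift]
    · intro u hu v hv huv
      simp only [Finset.mem_coe] at hu hv
      simp only [hu, hv, if_true] at huv
      refine hm2 (Finset.mem_of_mem_erase hu) (Finset.mem_of_mem_erase hv) ?_
      rw [← hg' u hu, ← hg' v hv, huv]
    · intro u hu
      simp only [hu, if_false]
    · funext u
      simp only [insertMark]
      split_ifs with h1 h2 h3
      · rw [h1]
      · rw [hNU, hg' u h3]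
      · exact absurd (Finset.mem_erase.mpr ⟨h1, h2⟩) h3
      · exact (hm3 u h2).symm
    · intro q hq
      refine Finset.min'_le _ _ (Finset.mem_filter.mpr ⟨hq.1, ?_⟩)
      rwa [hq.2.1]
  · intro U _ a ha k hk _ m hm
    obtain ⟨N, hN, hNU, hNe⟩ := size ha
    obtain ⟨hm1, hm2, hm3⟩ := hm
    rw [hNU] at hk ⊢
    rw [hNe] at hm1 ⊢
    have hlt : ∀ u ∈ U, u ≠ a → m u + 2 < N := fun u hu hua => by
      have := (hm1 u (Finset.mem_erase.mpr ⟨hua, hu⟩)).1; omega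
    have val : ∀ u ∈ U, u ≠ a → insertMark N U k a m u = markShift N k (m u) := by
      intro u hu hua; simp [insertMark, hu, hua]
    have vala : insertMark N U k a m a = k := by simp [insertMark]
    ext ⟨j, u⟩
    simp only [insertLeafData, markingLeaves, Set.mem_ofPred_eq, Prod.mk.injEq, Finset.mem_erase]
    constructor
    · rintro ⟨hu, rfl, hfree⟩
      by_cases hua : u = a
      · left; exact ⟨by rw [hua, vala], hua⟩
      right
      rw [val u hu hua] at *
      have hanc : m u ≠ anchor N k := by
        intro h
        apply hfree a ha
        rw [h, cpred_markShift_anchor hN, vala]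
      refine ⟨m u, ⟨⟨hua, hu⟩, rfl, ?_⟩, hanc, markShift_eq_shift (hlt u hu hua) hanc⟩
      rintro v ⟨hva, hv⟩ h
      apply hfree v hv
      rw [val v hv hva, markShift_eq_shift (hlt u hu hua) hanc]
      exact (markShift_eq_cpred_shift_iff hN hk (hlt u hu hua) (hlt v hv hva) hanc).mpr h
    · rintro (⟨rfl, rfl⟩ | ⟨j', ⟨⟨hua, hu⟩, rfl, hfree⟩, hanc, rfl⟩)
      · refine ⟨ha, vala, fun v hv => ?_⟩
        by_cases hva : v = u
        · rw [hva, vala]; grind [cpred]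
        · rw [val v hv hva]; exact (markShift_ne hk (hlt v hv hva)).2
      · refine ⟨hu, by rw [val u hu hua, markShift_eq_shift (hlt u hu hua) hanc], ?_⟩
        intro v hv
        by_cases hva : v = a
        · rw [hva, vala]; exact (cpred_shift_ne hN hk (hlt u hu hua) hanc).symm
        · rw [val v hv hva]
          exact fun h => hfree v ⟨hva, hv⟩
            ((markShift_eq_cpred_shift_iff hN hk (hlt u hu hua) (hlt v hv hva) hanc).mp h)
  · intro U _ a ha k hk hc m hm _
    obtain ⟨N, hN, hNU, hNe⟩ := size ha
    obtain ⟨hm1, hm2, hm3⟩ := hm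
    have hlt : ∀ u ∈ U, u ≠ a → m u + 2 < N := fun u hu hua => by
      have := (hm1 u (Finset.mem_erase.mpr ⟨hua, hu⟩)).1; omega
    have val : ∀ u ∈ U, u ≠ a → insertMark N U k a m u = markShift N k (m u) := by
      intro u hu hua; simp [insertMark, hu, hua]
    have vala : insertMark N U k a m a = k := by simp [insertMark]
    simp only [hNU] at hk ⊢
    refine ⟨fun u hu => ?_, fun u hu v hv huv => ?_, fun u hu => ?_⟩
    · rw [hNU]
      by_cases hua : u = a
      · subst hua; rw [vala]; exact ⟨hk, hc⟩
      · rw [val u hu hua]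
        refine ⟨markShift_lt (hlt u hu hua), ?_⟩
        rw [← hNU, even_markShift]
        exact (hm1 u (Finset.mem_erase.mpr ⟨hua, hu⟩)).2
    · by_cases hua : u = a <;> by_cases hva : v = a
      · rw [hua, hva]
      · rw [hua, vala, val v hv hva] at huv
        exact absurd huv.symm (markShift_ne hk (hlt v hv hva)).1
      · rw [hva, vala, val u hu hua] at huv
        exact absurd huv (markShift_ne hk (hlt u hu hua)).1
      · rw [val u hu hua, val v hv hva] at huv
        exact hm2 (Finset.mem_coe.mpr (Finset.mem_erase.mpr ⟨hua, hu⟩))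
          (Finset.mem_coe.mpr (Finset.mem_erase.mpr ⟨hva, hv⟩))
          (markShift_inj (hlt u hu hua) huv)
    · have : u ≠ a := fun h => hu (h ▸ ha)
      simp [insertMark, hu, this]
  · intro U _ a ha k hk _ m hm m' hm' h
    obtain ⟨N, hN, hNU, hNe⟩ := size ha
    simp only [hNU] at *
    funext u
    by_cases hu : u ∈ U.erase a
    · obtain ⟨hua, huU⟩ := Finset.mem_erase.mp hu
      have := congrFun h u
      simp only [insertMark, hua, huU, if_true, if_false] at this
      have h1 := (hm.1 u hu).1
      exact markShift_inj (by omega) this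
    · rw [hm.2.2 u hu, hm'.2.2 u hu]
  · rintro U _ m _ k k' a h h'
    exact h.2.1.symm.trans h'.2.1

end Marking

/-! ### Inserting a leaf into a route -/

section Route

variable {α : Type*}

/-- The leaves of a route with their positions: the entries that occur only once and whose two
cyclic neighbours are equal. -/
def routeLeaves (i : List α) : Set (ℕ × α) :=
  {p | i[p.1]? = some p.2 ∧ (∀ j, i[j]? = some p.2 → j = p.1) ∧
    i[cpred i.length p.1]? = i[csucc i.length p.1]?}

/-- Insertion of the leaf `a` at position `k` of a route, together with a second copy of the entry
at which it is attached. -/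
def insertLeaf (k : ℕ) (a : α) (i : List α) : List α :=
  (List.range (i.length + 2)).map fun j =>
    if j = k then a else i.getD (source (i.length + 2) k j) a

@[simp]
theorem length_insertLeaf (k : ℕ) (a : α) (i : List α) :
    (insertLeaf k a i).length = i.length + 2 := by
  simp [insertLeaf]

theorem source_lt {N k j : ℕ} (hN : 4 ≤ N) (hk : k < N) (hj : j < N) :
    source N k j + 2 < N := by
  grind [source, dup, anchor]

theorem source_shift {N k j : ℕ} (hj : j + 2 < N) : source N k (shift k j) = j := by
  grind [source, dup, anchor, shift]

theorem shift_source {N k j : ℕ} (hN : 4 ≤ N) (hj : j < N) (h : j ≠ k)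
    (h' : j ≠ dup N k) : shift k (source N k j) = j := by
  grind [source, dup, anchor, shift]

theorem shift_lt {N k j : ℕ} (hj : j + 2 < N) : shift k j < N := by
  grind [shift]

theorem shift_ne {k j : ℕ} : shift k j ≠ k := by
  grind [shift]

theorem getElem?_insertLeaf {k j : ℕ} {a : α} {i : List α} (hi : 2 ≤ i.length)
    (hk : k < i.length + 2) (hj : j < i.length + 2) :
    (insertLeaf k a i)[j]? = if j = k then some a else i[source (i.length + 2) k j]? := by
  have hj' : j < (List.range (i.length + 2)).length := by simpa
  rw [insertLeaf, List.getElem?_map, List.getElem?_eq_getElem hj', List.getElem_range]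
  simp only [Option.map_some]
  split_ifs with h
  · rfl
  · have := source_lt (by omega) hk hj
    rw [List.getD_eq_getElem?_getD, List.getElem?_eq_getElem (by omega)]
    rfl

theorem getElem?_insertLeaf_shift {k j : ℕ} {a : α} {i : List α} (hi : 2 ≤ i.length)
    (hk : k < i.length + 2) (hj : j < i.length) :
    (insertLeaf k a i)[shift k j]? = i[j]? := by
  rw [getElem?_insertLeaf hi hk (shift_lt (by omega)), if_neg shift_ne,
    source_shift (by omega)]

theorem lt_length_of_getElem?_eq_some {i : List α} {j : ℕ} {u : α} (h : i[j]? = some u) :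
    j < i.length := (List.getElem?_eq_some_iff.mp h).1

theorem mem_insertLeaf {k : ℕ} {a u : α} {i : List α} (hi : 2 ≤ i.length)
    (hk : k < i.length + 2) : u ∈ insertLeaf k a i ↔ u = a ∨ u ∈ i := by
  constructor
  · intro h
    obtain ⟨j, hj⟩ := List.mem_iff_getElem?.mp h
    have hj' := lt_length_of_getElem?_eq_some hj
    rw [length_insertLeaf] at hj'
    rw [getElem?_insertLeaf hi hk hj'] at hj
    split_ifs at hj with h1
    · left; simpa using hj.symm
    · right; exact List.mem_iff_getElem?.mpr ⟨_, hj⟩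
  · rintro (rfl | h)
    · exact List.mem_iff_getElem?.mpr ⟨k, by rw [getElem?_insertLeaf hi hk hk, if_pos rfl]⟩
    · obtain ⟨j, hj⟩ := List.mem_iff_getElem?.mp h
      exact List.mem_iff_getElem?.mpr ⟨shift k j, by
        rw [getElem?_insertLeaf_shift hi hk (lt_length_of_getElem?_eq_some hj), hj]⟩

theorem getElem?_insertLeaf_eq_self_iff {k j : ℕ} {a : α} {i : List α} (hi : 2 ≤ i.length)
    (hk : k < i.length + 2) (ha : a ∉ i) : (insertLeaf k a i)[j]? = some a ↔ j = k := by
  constructor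
  · intro h
    have hj := lt_length_of_getElem?_eq_some h
    rw [length_insertLeaf] at hj
    rw [getElem?_insertLeaf hi hk hj] at h
    by_contra hne
    rw [if_neg hne] at h
    exact ha (List.mem_iff_getElem?.mpr ⟨_, h⟩)
  · rintro rfl
    rw [getElem?_insertLeaf hi hk hk, if_pos rfl]

theorem even_source {L k j : ℕ} (h : j ≠ k) (hL : 2 ≤ L) :
    Even (source (2 * L) k j) ↔ Even j := by
  simp only [Nat.even_iff]; grind [source, dup, anchor]

theorem even_shift {k j : ℕ} : Even (shift k j) ↔ Even j := by
  simp only [Nat.even_iff]; grind [shift]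

/-- In a route of even length, inserting a leaf does not change the parities of the positions at
which the other labels occur. -/
theorem exists_even_getElem?_insertLeaf {k L : ℕ} {a u : α} {i : List α} (hi : 2 ≤ i.length)
    (hL : i.length + 2 = 2 * L) (hk : k < i.length + 2) (hu : u ≠ a) :
    (∃ j : ℕ, Even j ∧ (insertLeaf k a i)[j]? = some u) ↔ ∃ j : ℕ, Even j ∧ i[j]? = some u := by
  constructor
  · rintro ⟨j, hj, h⟩
    have hj' := lt_length_of_getElem?_eq_some h
    rw [length_insertLeaf] at hj'
    rw [getElem?_insertLeaf hi hk hj'] at h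
    split_ifs at h with h1
    · exact absurd (Option.some.inj h).symm hu
    · refine ⟨_, ?_, h⟩
      rw [hL, even_source h1 (by omega)]
      exact hj
  · rintro ⟨j, hj, h⟩
    exact ⟨shift k j, even_shift.mpr hj, by
      rw [getElem?_insertLeaf_shift hi hk (lt_length_of_getElem?_eq_some h), h]⟩

theorem source_eq_anchor_iff {N k j : ℕ} (hN : 4 ≤ N) (hk : k < N) (hj : j < N) (h : j ≠ k) :
    source N k j = anchor N k ↔ j = cpred N k ∨ j = csucc N k := by
  grind [source, dup, anchor, cpred, csucc]

theorem cpred_lt {N j : ℕ} (hj : j < N) : cpred N j < N := by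
  grind [cpred]

theorem csucc_lt {N j : ℕ} (hj : j < N) : csucc N j < N := by
  grind [csucc]

theorem cpred_ne {N j : ℕ} (hN : 2 ≤ N) : cpred N j ≠ j := by
  grind [cpred]

theorem csucc_ne {N j : ℕ} (hN : 2 ≤ N) : csucc N j ≠ j := by
  grind [csucc]

theorem cpred_csucc {N j : ℕ} : cpred N (csucc N j) = j := by
  grind [cpred, csucc]

theorem csucc_cpred {N j : ℕ} (hj : j < N) : csucc N (cpred N j) = j := by
  grind [cpred, csucc]

theorem cpred_shift_spec {N k j : ℕ} (hN : 4 ≤ N) (hk : k < N) (hj : j + 2 < N)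
    (h : j ≠ anchor N k) :
    cpred N (shift k j) ≠ k ∧ source N k (cpred N (shift k j)) = cpred (N - 2) j := by
  grind [cpred, anchor, shift, source, dup]

theorem csucc_shift_spec {N k j : ℕ} (hN : 4 ≤ N) (hk : k < N) (hj : j + 2 < N)
    (h : j ≠ anchor N k) :
    csucc N (shift k j) ≠ k ∧ source N k (csucc N (shift k j)) = csucc (N - 2) j := by
  grind [csucc, anchor, shift, source, dup]

theorem source_eq_iff {N k j j' : ℕ} (hN : 4 ≤ N) (hj : j < N) (hjk : j ≠ k)
    (h : j' ≠ anchor N k) (hj' : j' + 2 < N) : source N k j = j' ↔ j = shift k j' := by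
  grind [anchor, shift, source, dup]

/-- Inserting a leaf destroys exactly the leaf, if any, to which it is attached, since that label
then occurs twice. -/
theorem routeLeaves_insertLeaf {k : ℕ} {a : α} {i : List α} (hi : 2 ≤ i.length)
    (hk : k < i.length + 2) (ha : a ∉ i) :
    routeLeaves (insertLeaf k a i) = insertLeafData (i.length + 2) k a (routeLeaves i) := by
  have hN : 4 ≤ i.length + 2 := by omega
  ext ⟨j, u⟩
  simp only [insertLeafData, routeLeaves, Set.mem_ofPred_eq, Prod.mk.injEq, length_insertLeaf]
  by_cases hua : u = a
  · subst hua
    constructor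
    · rintro ⟨h1, -, -⟩
      exact Or.inl ⟨(getElem?_insertLeaf_eq_self_iff hi hk ha).mp h1, rfl⟩
    · rintro (⟨rfl, -⟩ | ⟨j', ⟨h1, -⟩, -⟩)
      · refine ⟨(getElem?_insertLeaf_eq_self_iff hi hk ha).mpr rfl,
          fun j' => (getElem?_insertLeaf_eq_self_iff hi hk ha).mp, ?_⟩
        rw [getElem?_insertLeaf hi hk (cpred_lt hk), getElem?_insertLeaf hi hk (csucc_lt hk),
          if_neg (cpred_ne (by omega)), if_neg (csucc_ne (by omega)),
          (source_eq_anchor_iff hN hk (cpred_lt hk) (cpred_ne (by omega))).mpr (Or.inl rfl),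
          (source_eq_anchor_iff hN hk (csucc_lt hk) (csucc_ne (by omega))).mpr (Or.inr rfl)]
      · exact absurd (List.mem_iff_getElem?.mpr ⟨_, h1⟩) ha
  -- away from the leaf and its two neighbours the insertion changes no neighbourhood
  have nbrs : ∀ j' < i.length, j' ≠ anchor (i.length + 2) k →
      ((insertLeaf k a i)[cpred (i.length + 2) (shift k j')]? = i[cpred i.length j']? ∧
      (insertLeaf k a i)[csucc (i.length + 2) (shift k j')]? = i[csucc i.length j']?) := by
    intro j' hj' hanc
    obtain ⟨h1, h2⟩ := cpred_shift_spec hN hk (show j' + 2 < i.length + 2 by omega) hanc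
    obtain ⟨h3, h4⟩ := csucc_shift_spec hN hk (show j' + 2 < i.length + 2 by omega) hanc
    have hs : shift k j' < i.length + 2 := shift_lt (by omega)
    rw [getElem?_insertLeaf hi hk (cpred_lt hs), getElem?_insertLeaf hi hk (csucc_lt hs),
      if_neg h1, if_neg h3, h2, h4]
    exact ⟨rfl, rfl⟩
  constructor
  · rintro ⟨h1, h2, h3⟩
    right
    have hj := lt_length_of_getElem?_eq_some h1
    rw [length_insertLeaf] at hj
    have hjk : j ≠ k := by
      rintro rfl
      rw [getElem?_insertLeaf hi hk hk, if_pos rfl] at h1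
      exact hua (Option.some.inj h1).symm
    have hs := source_lt hN hk hj
    have h1' := h1
    rw [getElem?_insertLeaf hi hk hj, if_neg hjk] at h1'
    -- the label at the anchor occurs on both sides of the new leaf
    have hanc : source (i.length + 2) k j ≠ anchor (i.length + 2) k := by
      intro h
      have e : ∀ j' < i.length + 2, j' ≠ k →
          source (i.length + 2) k j' = anchor (i.length + 2) k → j' = j := by
        intro j' hj' hne h'
        apply h2
        rw [getElem?_insertLeaf hi hk hj', if_neg hne, h', ← h, h1']
      have e1 := e _ (cpred_lt hk) (cpred_ne (by omega))
        ((source_eq_anchor_iff hN hk (cpred_lt hk) (cpred_ne (by omega))).mpr (Or.inl rfl))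
      have e2 := e _ (csucc_lt hk) (csucc_ne (by omega))
        ((source_eq_anchor_iff hN hk (csucc_lt hk) (csucc_ne (by omega))).mpr (Or.inr rfl))
      have : cpred (i.length + 2) k = csucc (i.length + 2) k := e1.trans e2.symm
      grind [cpred, csucc]
    have hsh : j = shift k (source (i.length + 2) k j) :=
      (source_eq_iff hN hj hjk hanc hs).mp rfl
    obtain ⟨n1, n2⟩ := nbrs _ (show source (i.length + 2) k j < i.length by omega) hanc
    refine ⟨_, ⟨h1', ?_, ?_⟩, hanc, hsh⟩
    · intro j' h
      have hj' := lt_length_of_getElem?_eq_some h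
      have := h2 (shift k j') (by rw [getElem?_insertLeaf_shift hi hk hj', h])
      rw [← this, source_shift (by omega)]
    · rw [← n1, ← n2, ← hsh, h3]
  · rintro (⟨-, h⟩ | ⟨j', ⟨h1, h2, h3⟩, hanc, rfl⟩)
    · exact absurd h hua
    have hj' := lt_length_of_getElem?_eq_some h1
    obtain ⟨n1, n2⟩ := nbrs _ hj' hanc
    refine ⟨by rw [getElem?_insertLeaf_shift hi hk hj', h1], ?_, by rw [n1, n2, h3]⟩
    intro j h
    have hj := lt_length_of_getElem?_eq_some h
    rw [length_insertLeaf] at hj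
    rw [getElem?_insertLeaf hi hk hj] at h
    split_ifs at h with hjk
    · exact absurd (Option.some.inj h).symm hua
    · exact (source_eq_iff hN hj hjk hanc (by omega)).mp (h2 _ h)

end Route

/-! ### Removing a leaf from a route -/

section Remove

open LinMultigraph

variable {α : Type*} [LinearOrder α]

theorem idxOf_eq_of_unique {i : List α} {k : ℕ} {a : α} (h : i[k]? = some a)
    (h' : ∀ j, i[j]? = some a → j = k) : i.idxOf a = k := by
  have hlt : i.idxOf a < i.length :=
    List.idxOf_lt_length_iff.mpr (List.mem_iff_getElem?.mpr ⟨k, h⟩)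
  apply h'
  rw [List.getElem?_eq_getElem hlt, List.getElem_idxOf hlt]

theorem length_removeFromRoute {i : List α} {a : α} (hi : 2 ≤ i.length) (ha : a ∈ i) :
    (removeFromRoute i a).length = i.length - 2 := by
  have hlt := List.idxOf_lt_length_iff.mpr ha
  rw [removeFromRoute]
  split_ifs with h
  · rw [List.length_take]; omega
  · rw [List.length_append, List.length_take, List.length_drop]; omega

theorem getElem?_removeFromRoute {i : List α} {a : α} {j : ℕ} (ha : a ∈ i)
    (hj : j + 2 < i.length) :
    (removeFromRoute i a)[j]? = i[shift (i.idxOf a) j]? := by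
  have hlt := List.idxOf_lt_length_iff.mpr ha
  rw [removeFromRoute, shift]
  split_ifs with h h1 h1
  · rw [List.getElem?_take_of_lt (by omega)]
  · omega
  · rw [List.getElem?_append_left (by rw [List.length_take]; omega),
      List.getElem?_take_of_lt h1]
  · rw [List.getElem?_append_right (by rw [List.length_take]; omega), List.getElem?_drop,
      List.length_take]
    congr 1; omega

theorem removeFromRoute_insertLeaf {k : ℕ} {a : α} {i : List α} (hi : 2 ≤ i.length)
    (hk : k < i.length + 2) (ha : a ∉ i) : removeFromRoute (insertLeaf k a i) a = i := by
  have hmem : a ∈ insertLeaf k a i := (mem_insertLeaf hi hk).mpr (Or.inl rfl)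
  have hidx : (insertLeaf k a i).idxOf a = k :=
    idxOf_eq_of_unique ((getElem?_insertLeaf_eq_self_iff hi hk ha).mpr rfl)
      fun j => (getElem?_insertLeaf_eq_self_iff hi hk ha).mp
  have hlen := length_removeFromRoute (by rw [length_insertLeaf]; omega) hmem
  rw [length_insertLeaf] at hlen
  apply List.ext_getElem?
  intro j
  by_cases hj : j < i.length
  · rw [getElem?_removeFromRoute hmem (by rw [length_insertLeaf]; omega), hidx,
      getElem?_insertLeaf_shift hi hk hj]
  · rw [List.getElem?_eq_none (by omega), List.getElem?_eq_none (by omega)]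

theorem insertLeaf_removeFromRoute {k : ℕ} {a : α} {i : List α} (hi : 4 ≤ i.length)
    (h : (k, a) ∈ routeLeaves i) : insertLeaf k a (removeFromRoute i a) = i := by
  obtain ⟨h1, h2, h3⟩ := h
  dsimp only at h1 h2 h3
  have hmem : a ∈ i := List.mem_iff_getElem?.mpr ⟨k, h1⟩
  have hidx := idxOf_eq_of_unique h1 h2
  have hk := lt_length_of_getElem?_eq_some h1
  have hlen := length_removeFromRoute (by omega) hmem
  apply List.ext_getElem?
  intro j
  by_cases hj : j < i.length
  · rw [getElem?_insertLeaf (by omega) (by omega) (by omega), hlen,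
      Nat.sub_add_cancel (by omega)]
    split_ifs with hjk
    · rw [hjk, h1]
    · have hs := source_lt hi hk hj
      rw [getElem?_removeFromRoute hmem hs, hidx]
      -- only one of the two neighbours of the leaf is kept, but they are equal
      by_cases hd : j = dup i.length k
      · have : j = csucc i.length k ∧ shift k (source i.length k j) = cpred i.length k ∨
            j = cpred i.length k ∧ shift k (source i.length k j) = csucc i.length k := by
          grind [dup, csucc, cpred, source, shift, anchor]
        rcases this with ⟨e, e'⟩ | ⟨e, e'⟩
        · rw [e', e, h3]
        · rw [e', e, h3]
      · rw [shift_source hi hj hjk hd]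
  · rw [List.getElem?_eq_none (by rw [length_insertLeaf]; omega), List.getElem?_eq_none (by omega)]

theorem removeFromRoute_subset (i : List α) (a : α) : removeFromRoute i a ⊆ i := by
  rw [removeFromRoute]
  split_ifs
  · exact List.take_subset _ _
  · exact List.append_subset.mpr ⟨List.take_subset _ _, List.drop_subset _ _⟩

/-! ### Circuit multigraphs and their routes -/

@[simp]
theorem route_ofRoute (i : List α) : (ofRoute i).route = i := by
  simp [route, ofRoute]

theorem ofRoute_injective : Function.Injective (ofRoute : List α → LinMultigraph α) :=
  Function.LeftInverse.injective route_ofRoute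

theorem isBalancedLeaf_ofRoute {i : List α} {v : α} :
    (ofRoute i).IsBalancedLeaf v ↔ 2 < i.length ∧ ∃ k, (k, v) ∈ routeLeaves i := by
  have tail : ∀ d : Fin i.length, i[d.val]? = some ((ofRoute i).f d).1 := fun d => by
    rw [List.getElem?_eq_getElem d.isLt]; rfl
  have head : ∀ d : Fin i.length, i[csucc i.length d.val]? = some ((ofRoute i).f d).2 := by
    intro d
    have hd := d.isLt
    have e : csucc i.length d.val = (d.val + 1) % i.length := by
      rw [csucc]
      split_ifs with h
      · rw [h, Nat.mod_self]
      · rw [Nat.mod_eq_of_lt (by omega)]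
    rw [e, List.getElem?_eq_getElem (Nat.mod_lt _ (by omega))]; rfl
  constructor
  · rintro ⟨h2, w, -, (e : Fin i.length), (e' : Fin i.length), he, he', hwe, hwe'⟩
    refine ⟨h2, e'.val, ?_, ?_, ?_⟩
    · exact (tail e').trans (congrArg (some ·.1) hwe')
    · intro j hj
      have hlt := lt_length_of_getElem?_eq_some hj
      have := tail ⟨j, hlt⟩
      rw [hj] at this
      exact congrArg Fin.val ((he' ⟨j, hlt⟩).mp (Option.some.inj this).symm)
    · -- the edge before the one with tail `v` has head `v`
      have hp : e = ⟨cpred i.length e'.val, cpred_lt e'.isLt⟩ := by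
        symm
        apply (he _).mp
        have := head ⟨cpred i.length e'.val, cpred_lt e'.isLt⟩
        dsimp only at this
        rw [csucc_cpred e'.isLt, tail, hwe'] at this
        exact (Option.some.inj this).symm
      have t := tail e
      rw [hwe, hp] at t
      have t' := head e'
      rw [hwe'] at t'
      exact t.trans t'.symm
  · rintro ⟨h2, k, h1, hu, hn⟩
    dsimp only at h1 hu hn
    have hk := lt_length_of_getElem?_eq_some h1
    have hp := cpred_lt hk
    obtain ⟨w, hw⟩ : ∃ w, i[cpred i.length k]? = some w :=
      ⟨_, List.getElem?_eq_getElem hp⟩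
    have ht := tail ⟨k, hk⟩
    have hh := head ⟨k, hk⟩
    have ht' := tail ⟨_, hp⟩
    have hh' := head ⟨_, hp⟩
    dsimp only at ht hh ht' hh'
    rw [h1] at ht
    rw [← hn, hw] at hh
    rw [hw] at ht'
    rw [csucc_cpred hk, h1] at hh'
    refine ⟨h2, w, ?_, ⟨_, hp⟩, ⟨k, hk⟩, fun d => ?_, fun d => ?_,
      Prod.ext (Option.some.inj ht').symm (Option.some.inj hh').symm,
      Prod.ext (Option.some.inj ht).symm (Option.some.inj hh).symm⟩
    · rintro rfl
      exact cpred_ne (by omega) (hu _ hw)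
    · constructor
      · intro hd
        have := hu _ ((head d).trans (congrArg some hd))
        apply Fin.ext
        exact cpred_csucc.symm.trans (congrArg (cpred i.length) this)
      · rintro rfl
        exact (Option.some.inj hh').symm
    · constructor
      · intro hd
        exact Fin.ext (hu _ ((tail d).trans (congrArg some hd)))
      · rintro rfl
        exact (Option.some.inj ht).symm

theorem mem_balancedLeaves_ofRoute {i : List α} {v : α} :
    v ∈ (ofRoute i).balancedLeaves ↔ 2 < i.length ∧ ∃ k, (k, v) ∈ routeLeaves i := by
  simp only [balancedLeaves, Finset.mem_filter]
  rw [isBalancedLeaf_ofRoute, and_iff_right_iff_imp]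
  rintro ⟨-, k, h, -⟩
  exact List.mem_toFinset.mpr (List.mem_iff_getElem?.mpr ⟨k, h⟩)

theorem removeLeaf_ofRoute (i : List α) (v : α) :
    (ofRoute i).removeLeaf v = ofRoute (removeFromRoute i v) := by
  rw [removeLeaf, route_ofRoute]

theorem seed_numEdges_le_and_verts_subset (G : LinMultigraph α) :
    G.seed.numEdges ≤ G.numEdges ∧ G.seed.verts ⊆ G.verts := by
  induction hn : G.numEdges using Nat.strong_induction_on generalizing G with
  | _ n ih =>
    rw [seed]
    split_ifs with h
    · have hlt := removeLeaf_numEdges_lt (Finset.min'_mem _ h)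
      obtain ⟨h1, h2⟩ := ih _ (hn ▸ hlt) _ rfl
      refine ⟨by omega, h2.trans ?_⟩
      intro v hv
      have := removeFromRoute_subset _ _ (List.mem_toFinset.mp hv)
      obtain ⟨e, rfl⟩ := List.mem_ofFn.mp this
      exact G.tail_mem e
    · exact ⟨hn.le, subset_rfl⟩

theorem seed_eq_self {G : LinMultigraph α} (h : ¬ G.balancedLeaves.Nonempty) : G.seed = G := by
  rw [seed, dif_neg h]

end Remove

/-! ### The number of markings -/

section Count

variable {α : Type*} [LinearOrder α]

theorem markings_finite (c : α → Prop) (L : ℕ) (U : Finset α) : (markings c L U).Finite := by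
  refine Set.Finite.of_injOn (f := fun m (u : U) => m u)
    (t := Set.pi Set.univ fun _ : U => Set.Iio (2 * L)) ?_ ?_
    (Set.Finite.pi fun _ => Set.finite_Iio _)
  · intro m hm u _
    exact (hm.1 u u.2).1
  · intro m hm m' hm' h
    funext u
    by_cases hu : u ∈ U
    · exact congrFun h ⟨u, hu⟩
    · rw [hm.2.2 u hu, hm'.2.2 u hu]

/-- A marking by the labels in `insert a U` is a marking by those in `U` together with a position
for `a` that is still free. -/
def markingsInsertEquiv (c : α → Prop) (L : ℕ) {U : Finset α} {a : α} (ha : a ∉ U) :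
    markings c L (insert a U) ≃
      Σ m : markings c L U, {k // (k < 2 * L ∧ (Even k ↔ c a)) ∧ ∀ u ∈ U, m.1 u ≠ k} where
  toFun m := ⟨⟨Function.update m.1 a 0, by
      obtain ⟨m, h1, h2, h3⟩ := m
      have e : ∀ u ∈ U, Function.update m a 0 u = m u := fun u hu =>
        Function.update_of_ne (ne_of_mem_of_not_mem hu ha) _ _
      refine ⟨fun u hu => ?_, fun u hu v hv huv => ?_, fun u hu => ?_⟩
      · rw [e u hu]; exact h1 u (Finset.mem_insert_of_mem hu)
      · rw [e u hu, e v hv] at huv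
        exact h2 (Finset.mem_insert_of_mem hu) (Finset.mem_insert_of_mem hv) huv
      · by_cases hua : u = a
        · rw [hua, Function.update_self]
        · rw [Function.update_of_ne hua]
          exact h3 u (by simp [hua, hu])⟩,
    ⟨m.1 a, m.2.1 a (Finset.mem_insert_self _ _), by
      obtain ⟨m, h1, h2, h3⟩ := m
      intro u hu h
      have hua : u ≠ a := fun h => ha (h ▸ hu)
      dsimp only at h
      rw [Function.update_of_ne hua] at h
      exact hua (h2 (Finset.mem_insert_of_mem hu) (Finset.mem_insert_self _ _) h)⟩⟩
  invFun s := ⟨Function.update s.1.1 a s.2.1, by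
    obtain ⟨⟨m, h1, h2, h3⟩, k, hk, hf⟩ := s
    dsimp only at hf ⊢
    have e : ∀ u ∈ U, Function.update m a k u = m u := fun u hu =>
      Function.update_of_ne (ne_of_mem_of_not_mem hu ha) _ _
    refine ⟨fun u hu => ?_, fun u hu v hv huv => ?_, fun u hu => ?_⟩
    · rcases Finset.mem_insert.mp hu with rfl | hu
      · rw [Function.update_self]; exact hk
      · rw [e u hu]; exact h1 u hu
    · rcases Finset.mem_insert.mp hu with hua | hu <;>
        rcases Finset.mem_insert.mp hv with hva | hv
      · rw [hua, hva]
      · rw [hua, e v hv, Function.update_self] at huv; exact absurd huv.symm (hf v hv)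
      · rw [hva, e u hu, Function.update_self] at huv; exact absurd huv (hf u hu)
      · rw [e u hu, e v hv] at huv; exact h2 hu hv huv
    · rw [Finset.mem_insert, not_or] at hu
      rw [Function.update_of_ne hu.1, h3 u hu.2]⟩
  left_inv m := by
    apply Subtype.ext
    simp
  right_inv s := by
    obtain ⟨⟨m, h1, h2, h3⟩, k, hk, hf⟩ := s
    have e : Function.update (Function.update m a k) a 0 = m := by
      rw [Function.update_idem, ← h3 a ha, Function.update_eq_self]
    exact Sigma.subtype_ext (Subtype.ext e) (Function.update_self _ _ _)

open Classical in
theorem card_range_filter_even (L : ℕ) (p : Prop) :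
    ((Finset.range (2 * L)).filter fun k => (Even k ↔ p)).card = L := by
  induction L with
  | zero => rfl
  | succ L ih =>
    have h : Finset.range (2 * (L + 1)) =
        insert (2 * L) (insert (2 * L + 1) (Finset.range (2 * L))) := by
      ext; simp only [Finset.mem_range, Finset.mem_insert]; omega
    rw [h, Finset.filter_insert, Finset.filter_insert]
    by_cases hp : p <;> simp [hp] at ih ⊢
    all_goals exact ih

open Classical in
/-- A mark of colour `c a` can be placed at the `L` positions of the right parity, apart from those
already taken by marks of the same colour. -/
theorem card_free_positions {α : Type*} (c : α → Prop) (L : ℕ) (U : Finset α) (a : α) {m : α → ℕ}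
    (hm : m ∈ markings c L U) :
    Nat.card {k // (k < 2 * L ∧ (Even k ↔ c a)) ∧ ∀ u ∈ U, m u ≠ k} =
      L - (U.filter fun u => (c u ↔ c a)).card := by
  obtain ⟨h1, h2, -⟩ := hm
  let A := (Finset.range (2 * L)).filter fun k => (Even k ↔ c a)
  let S := (U.filter fun u => (c u ↔ c a)).image m
  have hS : S ⊆ A := by
    intro k hk
    obtain ⟨u, hu, rfl⟩ := Finset.mem_image.mp hk
    obtain ⟨hu, huc⟩ := Finset.mem_filter.mp hu
    exact Finset.mem_filter.mpr ⟨Finset.mem_range.mpr (h1 u hu).1, (h1 u hu).2.trans huc⟩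
  have hcS : S.card = (U.filter fun u => (c u ↔ c a)).card :=
    Finset.card_image_of_injOn (h2.mono (by
      intro u hu; exact (Finset.mem_filter.mp hu).1))
  rw [Nat.subtype_card (A \ S), Finset.card_sdiff_of_subset hS, hcS, card_range_filter_even]
  intro k
  simp only [A, S, Finset.mem_sdiff, Finset.mem_filter, Finset.mem_range, Finset.mem_image,
    not_exists, not_and]
  refine and_congr_right fun hk => ⟨fun h u hu huk => ?_, fun h u hu huk => h u hu.1 huk⟩
  refine h u ⟨hu, ?_⟩ huk
  rw [← (h1 u hu).2, huk, hk.2]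

/-- The colours do not interact, as they use positions of different parities; each colour class is
placed injectively at `L` positions. -/
theorem ncard_markings (c : α → Prop) [DecidablePred c] (L : ℕ) (U : Finset α) :
    (markings c L U).ncard = L.descFactorial (U.filter c).card *
      L.descFactorial (U.filter fun u => ¬ c u).card := by
  induction U using Finset.induction_on with
  | empty =>
    have : markings c L ∅ = {fun _ => 0} := by
      ext m
      simp [markings, funext_iff]
    simp [this]
  | insert a U ha ih =>
    have := (markings_finite c L U).to_subtype
    have : Fintype (markings c L U) := Fintype.ofFinite _
    have hf : ∀ m : markings c L U,
        Finite {k // (k < 2 * L ∧ (Even k ↔ c a)) ∧ ∀ u ∈ U, m.1 u ≠ k} := fun m =>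
      ((Set.finite_Iio (2 * L)).subset fun k hk => hk.1.1).to_subtype
    rw [← Nat.card_coe_set_eq, Nat.card_congr (markingsInsertEquiv c L ha), Nat.card_sigma,
      Finset.sum_congr rfl fun m _ => card_free_positions c L U a m.2, Finset.sum_const,
      Finset.card_univ, ← Nat.card_eq_fintype_card, Nat.card_coe_set_eq, ih, smul_eq_mul]
    rw [Finset.filter_insert, Finset.filter_insert]
    by_cases hc : c a
    · simp only [hc, if_true, iff_true, not_true, if_false]
      rw [Finset.card_insert_of_notMem (by simp [ha]), Nat.descFactorial_succ]
      ring
    · simp only [hc, if_true, iff_false, not_false_iff, if_false]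
      rw [Finset.card_insert_of_notMem (by simp [ha]), Nat.descFactorial_succ]
      ring

end Count

/-! ### Routes with a given seed graph -/

section Seed

open LinMultigraph

variable {α : Type*} [LinearOrder α]

/-- The routes of the sprouting graphs of `G₀` with sprouting vertices `U`, where `c u` says that
`u` is black. -/
def seedRoutes (l₀ : ℕ) (c : α → Prop) (V₀ : Finset α) (G₀ : LinMultigraph α) (U : Finset α) :
    Set (List α) :=
  {i | i.length = 2 * (l₀ + U.card) ∧ i.toFinset = V₀ ∪ U ∧ (ofRoute i).seed = G₀ ∧
    ∀ u ∈ U, (∃ j : ℕ, Even j ∧ i[j]? = some u) ↔ c u}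

variable {l₀ : ℕ} {c : α → Prop} {V₀ : Finset α} {i₀ : List α}

theorem seed_ofRoute_eq_self (hleaf : ∀ v, ¬ (ofRoute i₀).IsBalancedLeaf v) :
    (ofRoute i₀).seed = ofRoute i₀ := by
  apply seed_eq_self
  rintro ⟨v, hv⟩
  simp only [balancedLeaves, Finset.mem_filter] at hv
  exact hleaf v hv.2

theorem seedRoutes_empty (hlen : i₀.length = 2 * l₀) (hV : i₀.toFinset = V₀)
    (hleaf : ∀ v, ¬ (ofRoute i₀).IsBalancedLeaf v) :
    seedRoutes l₀ c V₀ (ofRoute i₀) ∅ = {i₀} := by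
  ext i
  simp only [seedRoutes, Set.mem_ofPred_eq, Set.mem_singleton_iff]
  constructor
  · rintro ⟨h1, -, h3, -⟩
    by_cases h : (ofRoute i).balancedLeaves.Nonempty
    · rw [seed, dif_pos h] at h3
      have hlt := removeLeaf_numEdges_lt (Finset.min'_mem _ h)
      have hle := (seed_numEdges_le_and_verts_subset
        ((ofRoute i).removeLeaf ((ofRoute i).balancedLeaves.min' h))).1
      rw [h3] at hle
      have e1 : (ofRoute i).numEdges = i.length := rfl
      have e2 : (ofRoute i₀).numEdges = i₀.length := rfl
      simp only [Finset.card_empty] at h1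
      omega
    · rw [seed_eq_self h] at h3
      exact ofRoute_injective h3
  · rintro rfl
    exact ⟨by simpa using hlen, by simpa using hV, seed_ofRoute_eq_self hleaf, by simp⟩

theorem four_le_size_of_mem {U : Finset α} {a : α} (hl₀ : 1 ≤ l₀) (ha : a ∈ U) :
    4 ≤ 2 * (l₀ + U.card) ∧ 2 * (l₀ + (U.erase a).card) + 2 = 2 * (l₀ + U.card) := by
  have := Finset.card_pos.mpr ⟨a, ha⟩
  rw [Finset.card_erase_of_mem ha]; omega

theorem notMem_of_mem_seedRoutes {U : Finset α} {a : α} {i : List α} {G₀ : LinMultigraph α}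
    (hd : Disjoint V₀ U) (ha : a ∈ U) (hi : i ∈ seedRoutes l₀ c V₀ G₀ (U.erase a)) : a ∉ i := by
  intro h
  have := List.mem_toFinset.mpr h
  rw [hi.2.1, Finset.mem_union] at this
  rcases this with h | h
  · exact Finset.disjoint_left.mp hd h ha
  · simp at h

/-- The first step of the computation of the seed graph removes a sprouting vertex, and that step is
undone by inserting a leaf. -/
theorem exists_insertLeaf_of_mem_seedRoutes (hl₀ : 1 ≤ l₀) (hlen : i₀.length = 2 * l₀)
    (hV : i₀.toFinset = V₀) {U : Finset α} (hne : U.Nonempty) {i : List α}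
    (hi : i ∈ seedRoutes l₀ c V₀ (ofRoute i₀) U) :
    ∃ k a i', a ∈ U ∧ k < 2 * (l₀ + U.card) ∧ (Even k ↔ c a) ∧
      i' ∈ seedRoutes l₀ c V₀ (ofRoute i₀) (U.erase a) ∧ insertLeaf k a i' = i ∧
      ∀ p ∈ routeLeaves i, a ≤ p.2 := by
  obtain ⟨h1, h2, h3, h4⟩ := hi
  have hU := Finset.card_pos.mpr hne
  have hex : (ofRoute i).balancedLeaves.Nonempty := by
    by_contra h
    rw [seed_eq_self h] at h3
    have := congrArg List.length (ofRoute_injective h3)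
    omega
  rw [seed, dif_pos hex] at h3
  obtain ⟨-, k, hk⟩ := mem_balancedLeaves_ofRoute.mp (Finset.min'_mem _ hex)
  have hmin : ∀ p ∈ routeLeaves i, (ofRoute i).balancedLeaves.min' hex ≤ p.2 := fun p hp =>
    Finset.min'_le _ _ (mem_balancedLeaves_ofRoute.mpr ⟨by omega, p.1, hp⟩)
  generalize (ofRoute i).balancedLeaves.min' hex = a at h3 hk hmin
  rw [removeLeaf_ofRoute] at h3
  have hins := insertLeaf_removeFromRoute (by omega) hk
  have hai : a ∈ i := List.mem_iff_getElem?.mpr ⟨k, hk.1⟩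
  have hlen' := length_removeFromRoute (by omega) hai
  have hki := lt_length_of_getElem?_eq_some hk.1
  dsimp only at hki
  have hidx := idxOf_eq_of_unique hk.1 hk.2.1
  have hnot : a ∉ removeFromRoute i a := by
    intro h
    obtain ⟨j, hj⟩ := List.mem_iff_getElem?.mp h
    have hj' := lt_length_of_getElem?_eq_some hj
    rw [getElem?_removeFromRoute hai (by omega), hidx] at hj
    exact shift_ne (hk.2.1 _ hj)
  generalize removeFromRoute i a = i' at h3 hins hlen' hnot
  have hi2 : 2 ≤ i'.length := by omega
  have hki' : k < i'.length + 2 := by omega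
  have hmem : ∀ u, u ∈ V₀ ∪ U ↔ u = a ∨ u ∈ i' := by
    intro u
    rw [← h2, ← hins, List.mem_toFinset, mem_insertLeaf hi2 hki']
  -- the vertices of the seed graph survive, so the removed leaf is a sprouting vertex
  have haV : a ∉ V₀ := by
    intro h
    have hsub := (seed_numEdges_le_and_verts_subset (ofRoute i')).2
    rw [h3] at hsub
    exact hnot (List.mem_toFinset.mp (hsub (show a ∈ i₀.toFinset by rwa [hV])))
  have haU : a ∈ U := by
    rcases Finset.mem_union.mp ((hmem a).mpr (Or.inl rfl)) with h | h
    · exact absurd h haV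
    · exact h
  have hc := four_le_size_of_mem hl₀ haU
  refine ⟨k, a, i', haU, by omega, ?_, ⟨by omega, ?_, h3, ?_⟩, hins, hmin⟩
  · rw [← h4 a haU]
    refine ⟨fun h => ⟨k, h, hk.1⟩, ?_⟩
    rintro ⟨j, hj, h⟩
    have : j = k := hk.2.1 j h
    rwa [← this]
  · ext u
    have := hmem u
    simp only [List.mem_toFinset, Finset.mem_union, Finset.mem_erase] at this ⊢
    by_cases hua : u = a
    · simp [hua, haV, hnot]
    · simp only [hua, false_or] at this
      simp [hua, ← this]
  · intro u hu
    obtain ⟨hua, hu⟩ := Finset.mem_erase.mp hu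
    rw [← h4 u hu, ← hins]
    exact (exists_even_getElem?_insertLeaf hi2
      (show i'.length + 2 = 2 * (l₀ + U.card) by omega) hki' hua).symm

/-- A vertex of the seed graph can only be a leaf if the seed graph has two edges and two
vertices: it would be a balanced leaf of the seed graph if that were longer. -/
theorem eq_one_and_card_eq_two_of_leaf (hl₀ : 1 ≤ l₀) (hlen : i₀.length = 2 * l₀)
    (hV : i₀.toFinset = V₀) (hleaf : ∀ v, ¬ (ofRoute i₀).IsBalancedLeaf v) {U : Finset α}
    (hd : Disjoint V₀ U) {i : List α} (hi : i ∈ seedRoutes l₀ c V₀ (ofRoute i₀) U)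
    {p : ℕ × α} (hp : p ∈ routeLeaves i) (hpV : p.2 ∈ V₀) : l₀ = 1 ∧ V₀.card = 2 := by
  induction hn : U.card generalizing U i p with
  | zero =>
    obtain rfl := Finset.card_eq_zero.mp hn
    rw [seedRoutes_empty hlen hV hleaf] at hi
    obtain rfl : i = i₀ := hi
    have hl : l₀ = 1 := by
      by_contra h
      exact hleaf p.2 (isBalancedLeaf_ofRoute.mpr ⟨by omega, p.1, hp⟩)
    refine ⟨hl, ?_⟩
    subst hl
    obtain ⟨x, y, rfl⟩ := List.length_eq_two.mp hlen
    have hxy : x ≠ y := by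
      rintro rfl
      obtain ⟨h1, h2, -⟩ := hp
      have hpx : x = p.2 := by
        have : p.2 ∈ [x, x] := List.mem_iff_getElem?.mpr ⟨_, h1⟩
        simpa [eq_comm] using this
      have e0 := h2 0 (by simp [← hpx])
      have e1 := h2 1 (by simp [← hpx])
      omega
    rw [← hV]
    simp [hxy]
  | succ n ih =>
    obtain ⟨k, a, i', haU, hk, -, hi', rfl, -⟩ := exists_insertLeaf_of_mem_seedRoutes hl₀ hlen hV
      (Finset.card_pos.mp (by omega)) hi
    have hc := four_le_size_of_mem hl₀ haU
    have hl' := hi'.1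
    rw [routeLeaves_insertLeaf (by omega) (by omega) (notMem_of_mem_seedRoutes hd haU hi')] at hp
    rcases hp with rfl | ⟨j, hj, -⟩
    · exact absurd haU (Finset.disjoint_left.mp hd hpV)
    · exact ih (hd.mono_right (Finset.erase_subset _ _)) hi' hj hpV
        (by rw [Finset.card_erase_of_mem haU]; omega)

/-- If the new leaf is the smallest leaf, then it is the first to be removed, and the seed graph
does not change. -/
theorem insertLeaf_mem_seedRoutes (hl₀ : 1 ≤ l₀) {G₀ : LinMultigraph α} {U : Finset α} {a : α}
    (hd : Disjoint V₀ U) (ha : a ∈ U) {k : ℕ} (hk : k < 2 * (l₀ + U.card)) (hc : Even k ↔ c a)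
    {i : List α} (hi : i ∈ seedRoutes l₀ c V₀ G₀ (U.erase a))
    (hmin : ∀ p ∈ routeLeaves (insertLeaf k a i), a ≤ p.2) :
    insertLeaf k a i ∈ seedRoutes l₀ c V₀ G₀ U := by
  have hN := four_le_size_of_mem hl₀ ha
  have hai := notMem_of_mem_seedRoutes hd ha hi
  obtain ⟨h1, h2, h3, h4⟩ := hi
  have hi2 : 2 ≤ i.length := by omega
  have hki : k < i.length + 2 := by omega
  refine ⟨by rw [length_insertLeaf]; omega, ?_, ?_, ?_⟩
  · ext u
    rw [List.mem_toFinset, mem_insertLeaf hi2 hki, ← List.mem_toFinset, h2]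
    by_cases hua : u = a <;> simp [hua, ha]
  · have hmem : a ∈ (ofRoute (insertLeaf k a i)).balancedLeaves := by
      refine mem_balancedLeaves_ofRoute.mpr ⟨by rw [length_insertLeaf]; omega, k, ?_⟩
      rw [routeLeaves_insertLeaf hi2 hki hai]
      exact mem_insertLeafData_self _ _ _ _
    have heq : (ofRoute (insertLeaf k a i)).balancedLeaves.min' ⟨a, hmem⟩ = a := by
      refine le_antisymm (Finset.min'_le _ _ hmem) (Finset.le_min' _ _ _ fun u hu => ?_)
      obtain ⟨-, j, hj⟩ := mem_balancedLeaves_ofRoute.mp hu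
      exact hmin _ hj
    rw [seed, dif_pos ⟨a, hmem⟩, heq, removeLeaf_ofRoute, removeFromRoute_insertLeaf hi2 hki hai,
      h3]
  · intro u hu
    by_cases hua : u = a
    · subst hua
      rw [← hc]
      simp only [getElem?_insertLeaf_eq_self_iff hi2 hki hai]
      simp
    · rw [exists_even_getElem?_insertLeaf hi2 (show i.length + 2 = 2 * (l₀ + U.card) by omega)
        hki hua]
      exact h4 u (Finset.mem_erase.mpr ⟨hua, hu⟩)

/-- Only the leaves among the sprouting vertices are recorded; the order hypothesis makes sure that
no vertex of the seed graph is ever removed in place of a sprouting vertex. -/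
theorem seedRoutes_leafSystem (hl₀ : 1 ≤ l₀) (hlen : i₀.length = 2 * l₀)
    (hV : i₀.toFinset = V₀) (hleaf : ∀ v, ¬ (ofRoute i₀).IsBalancedLeaf v) {U₀ : Finset α}
    (hd : Disjoint V₀ U₀) (hlt : l₀ = 1 → V₀.card = 2 → ∀ v ∈ V₀, ∀ u ∈ U₀, u < v) :
    LeafSystem l₀ c U₀ (seedRoutes l₀ c V₀ (ofRoute i₀))
      (fun U i => {p | p ∈ routeLeaves i ∧ p.2 ∈ U}) (fun _ => insertLeaf) := by
  have leaves_eq : ∀ U ⊆ U₀, ∀ a ∈ U, ∀ k < 2 * (l₀ + U.card),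
      ∀ i ∈ seedRoutes l₀ c V₀ (ofRoute i₀) (U.erase a), routeLeaves (insertLeaf k a i) =
        insertLeafData (2 * (l₀ + U.card)) k a (routeLeaves i) := by
    intro U hU a ha k hk i hi
    have hN := four_le_size_of_mem hl₀ ha
    have h1 := hi.1
    rw [routeLeaves_insertLeaf (by omega) (by omega)
      (notMem_of_mem_seedRoutes (hd.mono_right hU) ha hi)]
    congr 1
    omega
  constructor
  · refine ⟨i₀, seedRoutes_empty hlen hV hleaf, ?_⟩
    ext p
    simp
  · intro U hU hne i hi
    obtain ⟨k, a, i', h1, h2, h3, h4, h5, h6⟩ :=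
      exists_insertLeaf_of_mem_seedRoutes hl₀ hlen hV hne hi
    exact ⟨k, a, i', h1, h2, h3, h4, h5, fun p hp => h6 p hp.1⟩
  · intro U hU a ha k hk _ i hi
    rw [leaves_eq U hU a ha k hk i hi]
    have hai := notMem_of_mem_seedRoutes (hd.mono_right hU) ha hi
    ext ⟨j, u⟩
    simp only [insertLeafData, Set.mem_ofPred_eq, Prod.mk.injEq, Finset.mem_erase]
    constructor
    · rintro ⟨h | ⟨j', h1, h2, h3⟩, hu⟩
      · exact Or.inl h
      · refine Or.inr ⟨j', ⟨h1, ?_, hu⟩, h2, h3⟩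
        rintro rfl
        exact hai (List.mem_iff_getElem?.mpr ⟨_, h1.1⟩)
    · rintro (⟨rfl, rfl⟩ | ⟨j', ⟨h1, -, hu⟩, h2, h3⟩)
      · exact ⟨Or.inl ⟨rfl, rfl⟩, ha⟩
      · exact ⟨Or.inr ⟨j', h1, h2, h3⟩, hu⟩
  · intro U hU a ha k hk hc i hi hmin
    have hdU := hd.mono_right hU
    refine insertLeaf_mem_seedRoutes hl₀ hdU ha hk hc hi fun p hp => ?_
    rw [leaves_eq U hU a ha k hk i hi] at hp
    rcases hp with rfl | ⟨j, hj, hj', hj''⟩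
    · exact le_rfl
    have hpi : p.2 ∈ V₀ ∪ U.erase a := by
      rw [← hi.2.1, List.mem_toFinset]
      exact List.mem_iff_getElem?.mpr ⟨_, hj.1⟩
    rcases Finset.mem_union.mp hpi with h | h
    · -- the leaves among the vertices of the seed graph are never the smallest ones
      obtain ⟨e1, e2⟩ := eq_one_and_card_eq_two_of_leaf hl₀ hlen hV hleaf
        (hdU.mono_right (Finset.erase_subset _ _)) hi hj h
      exact (hlt e1 e2 _ h a (hU ha)).le
    · exact hmin p (Or.inr ⟨j, ⟨hj, h⟩, hj', hj''⟩)
  · intro U hU a ha k hk _ i hi i' hi' h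
    have hN := four_le_size_of_mem hl₀ ha
    have h1 := hi.1
    have h1' := hi'.1
    rw [← removeFromRoute_insertLeaf (by omega) (by omega)
      (notMem_of_mem_seedRoutes (hd.mono_right hU) ha hi) (k := k), h,
      removeFromRoute_insertLeaf (by omega) (by omega)
      (notMem_of_mem_seedRoutes (hd.mono_right hU) ha hi')]
  · intro U _ i _ k k' a h h'
    exact h'.1.2.1 k h.1.1

end Seed

/-! ### Sprouting graphs -/

section Sprouting

open LinMultigraph

variable {α : Type*} [LinearOrder α]

theorem mem_black_ofRoute {i : List α} {u : α} :
    u ∈ (ofRoute i).black ↔ ∃ j : ℕ, Even j ∧ i[j]? = some u := by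
  simp only [black, Finset.mem_filter]
  constructor
  · rintro ⟨-, e, he, rfl⟩
    refine ⟨e.val, ?_, List.getElem?_eq_getElem e.isLt⟩
    rwa [Nat.odd_add_one, Nat.not_odd_iff_even] at he
  · rintro ⟨j, hj, h⟩
    refine ⟨List.mem_toFinset.mpr (List.mem_iff_getElem?.mpr ⟨j, h⟩),
      ⟨j, lt_length_of_getElem?_eq_some h⟩, hj.add_one, ?_⟩
    exact (List.getElem?_eq_some_iff.mp h).2

theorem sproutingGraphs_eq_image {l₀ : ℕ} {B W : Finset α} (hBW : Disjoint B W) {i₀ : List α}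
    (hlen : i₀.length = 2 * l₀) :
    sproutingGraphs (ofRoute i₀) B W =
      ofRoute '' seedRoutes l₀ (· ∈ B) i₀.toFinset (ofRoute i₀) (B ∪ W) := by
  have hnum : (ofRoute i₀).numEdges + 2 * (B.card + W.card) = 2 * (l₀ + (B ∪ W).card) := by
    rw [Finset.card_union_of_disjoint hBW, show (ofRoute i₀).numEdges = i₀.length from rfl, hlen]
    ring
  have hblack : ∀ i : List α, (ofRoute i).black ∩ (B ∪ W) = B ↔
      ∀ u ∈ B ∪ W, (∃ j : ℕ, Even j ∧ i[j]? = some u) ↔ u ∈ B := by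
    intro i
    simp only [← mem_black_ofRoute]
    constructor
    · intro h u hu
      rw [Finset.ext_iff] at h
      rw [← h u, Finset.mem_inter, and_iff_left hu]
    · intro h
      ext u
      rw [Finset.mem_inter]
      constructor
      · rintro ⟨h1, h2⟩
        exact (h u h2).mp h1
      · intro hu
        have hu' := Finset.mem_union_left W hu
        exact ⟨(h u hu').mpr hu, hu'⟩
  ext G
  rw [sproutingGraphs, hnum]
  constructor
  · rintro ⟨⟨i, h1, h2, rfl⟩, h3, h4⟩
    exact ⟨i, ⟨h1, h2, h3, (hblack i).mp h4⟩, rfl⟩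
  · rintro ⟨i, ⟨h1, h2, h3, h4⟩, rfl⟩
    exact ⟨⟨i, h1, h2, rfl⟩, h3, (hblack i).mpr h4⟩

theorem ncard_sproutingGraphs {l₀ : ℕ} (hl₀ : 1 ≤ l₀) {B W : Finset α} (hBW : Disjoint B W)
    {i₀ : List α} (hlen : i₀.length = 2 * l₀) (hd : Disjoint i₀.toFinset (B ∪ W))
    (hleaf : ∀ v, ¬ (ofRoute i₀).IsBalancedLeaf v)
    (hlt : l₀ = 1 → i₀.toFinset.card = 2 → ∀ v ∈ i₀.toFinset, ∀ u ∈ B ∪ W, u < v) :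
    (sproutingGraphs (ofRoute i₀) B W).ncard =
      (l₀ + B.card + W.card).descFactorial B.card *
        (l₀ + B.card + W.card).descFactorial W.card := by
  rw [sproutingGraphs_eq_image hBW hlen, Set.ncard_image_of_injective _ ofRoute_injective,
    (seedRoutes_leafSystem hl₀ hlen rfl hleaf hd hlt).ncard_eq
      (markings_leafSystem l₀ hl₀ (· ∈ B) (B ∪ W)) subset_rfl, ncard_markings,
    Finset.card_union_of_disjoint hBW, ← add_assoc]
  have e1 : (B ∪ W).filter (· ∈ B) = B := by
    ext u; simp only [Finset.mem_filter, Finset.mem_union]; tauto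
  have e2 : (B ∪ W).filter (· ∉ B) = W := by
    ext u
    have := fun h : u ∈ W => Finset.disjoint_right.mp hBW h
    simp only [Finset.mem_filter, Finset.mem_union]; tauto
  rw [e1, e2]

theorem descFactorial_mul_descFactorial_eq_div (l b w : ℕ) :
    (((l + b + w).descFactorial b * (l + b + w).descFactorial w : ℕ) : ℚ) =
      ((l + b + w).factorial : ℚ) ^ 2 / (((l + b).factorial : ℚ) * ((l + w).factorial : ℚ)) := by
  have h1 := Nat.factorial_mul_descFactorial (show b ≤ l + b + w by omega)
  have h2 := Nat.factorial_mul_descFactorial (show w ≤ l + b + w by omega)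
  rw [show l + b + w - b = l + w by omega] at h1
  rw [show l + b + w - w = l + b by omega] at h2
  have p1 : ((l + b).factorial : ℚ) ≠ 0 := by exact_mod_cast Nat.factorial_ne_zero _
  have p2 : ((l + w).factorial : ℚ) ≠ 0 := by exact_mod_cast Nat.factorial_ne_zero _
  rw [eq_div_iff (mul_ne_zero p1 p2), sq]
  nth_rewrite 1 [← h1]
  rw [← h2]
  push_cast
  ring

theorem alternating_spec (l₀ : ℕ) (hl₀ : 1 ≤ l₀) (v₁ v₂ : α) :
    (List.replicate l₀ [v₁, v₂]).flatten.length = 2 * l₀ ∧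
      (List.replicate l₀ [v₁, v₂]).flatten.toFinset = {v₁, v₂} := by
  constructor
  · simp [mul_comm]
  · ext u
    simp only [List.mem_toFinset, List.mem_flatten, List.mem_replicate]
    constructor
    · rintro ⟨l, ⟨-, rfl⟩, h⟩
      simpa using h
    · intro h
      exact ⟨_, ⟨by omega, rfl⟩, by simpa using h⟩

theorem not_isBalancedLeaf_alternating (l₀ : ℕ) {v₁ v₂ : α} (v : α) :
    ¬ (alternating l₀ v₁ v₂).IsBalancedLeaf v := by
  rw [alternating, isBalancedLeaf_ofRoute]
  rintro ⟨h2, k, h1, hu, -⟩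
  dsimp only at h1 hu
  -- a route of length at least four starts with `v₁, v₂, v₁, v₂`
  obtain ⟨n, rfl⟩ : ∃ n, l₀ = n + 2 := ⟨l₀ - 2, by simp at h2; omega⟩
  have hv : v = v₁ ∨ v = v₂ := by
    have := List.mem_iff_getElem?.mpr ⟨k, h1⟩
    simp only [List.mem_flatten, List.mem_replicate] at this
    obtain ⟨l, ⟨-, rfl⟩, h⟩ := this
    simpa using h
  simp only [List.replicate_succ, List.flatten_cons] at hu
  rcases hv with rfl | rfl
  · have a := hu 0 (by simp)
    have b := hu 2 (by simp)
    omega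
  · have a := hu 1 (by simp)
    have b := hu 3 (by simp)
    omega

end Sprouting

end SproutingCount

theorem proposition5p2 {α : Type*} [LinearOrder α] (l₀ : ℕ) (hl₀ : 1 ≤ l₀)
    (B' W' : Finset α) (hBW : Disjoint B' W') :
    (∀ v₁ v₂ : α, v₁ ≠ v₂ → (∀ u ∈ B' ∪ W', u < v₁ ∧ u < v₂) →
      ((LinMultigraph.sproutingGraphs (LinMultigraph.alternating l₀ v₁ v₂) B' W').ncard : ℚ) =
        ((l₀ + B'.card + W'.card).factorial : ℚ) ^ 2 /
          (((l₀ + B'.card).factorial : ℚ) * ((l₀ + W'.card).factorial : ℚ))) ∧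
    (∀ (V₀ : Finset α) (G₀ : LinMultigraph α),
      Disjoint V₀ (B' ∪ W') →
      G₀ ∈ LinMultigraph.circuitMultigraphs V₀ (2 * l₀) →
      (∀ v, ¬ G₀.IsBalancedLeaf v) →
      (l₀ = 1 → V₀.card = 2 → ∀ v ∈ V₀, ∀ u ∈ B' ∪ W', u < v) →
      ((LinMultigraph.sproutingGraphs G₀ B' W').ncard : ℚ) =
        ((l₀ + B'.card + W'.card).factorial : ℚ) ^ 2 /
          (((l₀ + B'.card).factorial : ℚ) * ((l₀ + W'.card).factorial : ℚ))) := by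
  have main : ∀ (V₀ : Finset α) (G₀ : LinMultigraph α),
      Disjoint V₀ (B' ∪ W') →
      G₀ ∈ LinMultigraph.circuitMultigraphs V₀ (2 * l₀) →
      (∀ v, ¬ G₀.IsBalancedLeaf v) →
      (l₀ = 1 → V₀.card = 2 → ∀ v ∈ V₀, ∀ u ∈ B' ∪ W', u < v) →
      ((LinMultigraph.sproutingGraphs G₀ B' W').ncard : ℚ) =
        ((l₀ + B'.card + W'.card).factorial : ℚ) ^ 2 /
          (((l₀ + B'.card).factorial : ℚ) * ((l₀ + W'.card).factorial : ℚ)) := by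
    rintro V₀ G₀ hd ⟨i₀, hlen, rfl, rfl⟩ hleaf hlt
    rw [SproutingCount.ncard_sproutingGraphs hl₀ hBW hlen hd hleaf hlt,
      SproutingCount.descFactorial_mul_descFactorial_eq_div]
  refine ⟨fun v₁ v₂ _ hlt => ?_, main⟩
  -- the alternating graph is a seed graph as in the second part
  have hlt' : ∀ v ∈ ({v₁, v₂} : Finset α), ∀ u ∈ B' ∪ W', u < v := by
    intro v hv u hu
    rcases Finset.mem_insert.mp hv with rfl | hv
    · exact (hlt u hu).1
    · rw [Finset.mem_singleton.mp hv]; exact (hlt u hu).2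
  obtain ⟨h1, h2⟩ := SproutingCount.alternating_spec l₀ hl₀ v₁ v₂
  refine main {v₁, v₂} _ ?_ ⟨_, h1, h2, rfl⟩
    (SproutingCount.not_isBalancedLeaf_alternating l₀) fun _ _ => hlt'
  exact Finset.disjoint_left.mpr fun v hv hu => lt_irrefl v (hlt' v hv v hu)
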